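/- For a finite simple graph $G$ with $n$ vertices and $m$ edges let $LI(G)=L(G)-\frac{2m}{n}I_n$, where $L(G)$ is the Laplacian matrix of $G$, and let $\sigma_1(LI(G))$ be the largest singular value of $LI(G)$. A bicyclic graph is a connected graph with $n$ vertices and $n+1$ edges. For $n\ge 6$ let $B_n^1$ be the bicyclic graph on $n$ vertices that consists of two disjoint triangles joined by a path (from a vertex of one triangle to a vertex of the other); explicitly, the path $v_1v_2\cdots v_n$ together with the edges $v_1v_3$ and $v_{n-2}v_n$. Write $B_n^*$ for any graph obtained from the star $K_{1,n-1}$ by adding two edges (up to isomorphism there are two such graphs for $n\ge 5$, according to whether the two added edges share a vertex or not). Let $B_n$ be a bicyclic graph with $n\ge 17$ vertices. Then, for each graph $B_n^*$, $$\sigma_1(LI(B_n^1))\le \sigma_1(LI(B_n))\le \sigma_1(LI(B_n^*)).$$ Equality on the left holds if and only if $B_n\cong B_n^1$. Equality on the right holds if and only if $B_n$ is isomorphic to a graph obtained from the star $K_{1,n-1}$ by adding two edges. -/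

import Mathlib

/-- A bicyclic graph: a connected graph with exactly one more edge than vertices. -/
def SimpleGraph.IsBicyclic {V : Type*} [Fintype V] (G : SimpleGraph V) : Prop :=
  G.Connected ∧ G.edgeSet.ncard = Fintype.card V + 1

open Classical in
/-- The matrix `LI(G) = L(G) - (2m/n) I`, where `L(G)` is the Laplacian matrix of `G`, `m` its
number of edges and `n` its number of vertices. -/
noncomputable def SimpleGraph.LI {V : Type*} [Fintype V] (G : SimpleGraph V) : Matrix V V ℝ :=
  G.lapMatrix ℝ - (2 * (G.edgeSet.ncard : ℝ) / (Fintype.card V : ℝ)) • (1 : Matrix V V ℝ)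

open Classical in
/-- `σ₁(M)`, the largest singular value of a real square matrix `M`
(Mathlib lists singular values in decreasing order, starting from index `0`). -/
noncomputable def Matrix.sigmaOne {V : Type*} [Fintype V] (M : Matrix V V ℝ) : ℝ :=
  (Matrix.toEuclideanLin M).singularValues 0

/-- The graph `B_n^1` (for `n ≥ 6`): two disjoint triangles joined by a path. On the vertices
`0, …, n - 1`, it is the path `0 - 1 - ⋯ - (n - 1)` together with the two edges
`{0, 2}` and `{n - 3, n - 1}`. -/
def bicyclicOne (n : ℕ) : SimpleGraph (Fin n) :=
  SimpleGraph.fromRel fun i j : Fin n =>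
    i.val + 1 = j.val ∨ (i.val = 0 ∧ j.val = 2) ∨ (i.val + 3 = n ∧ j.val + 1 = n)

/-- `G` is obtained from a star on all its vertices by adding two (distinct, new) edges. -/
def SimpleGraph.IsStarPlusTwoEdges {V : Type*} (G : SimpleGraph V) : Prop :=
  ∃ (c : V) (e f : Sym2 V), e ≠ f ∧
    e ∈ (SimpleGraph.starGraph c)ᶜ.edgeSet ∧ f ∈ (SimpleGraph.starGraph c)ᶜ.edgeSet ∧
    G = SimpleGraph.starGraph c ⊔ SimpleGraph.fromEdgeSet {e, f}

/-! ### Largest singular value of a symmetric matrix through its quadratic form -/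

open Matrix

/-! Let `d = 2m/n` be the average degree. The eigenvalues of `LI(G)` are `μ - d` for Laplacian
eigenvalues `μ ≥ 0`, so `σ₁` is governed by the largest `μ` as soon as that is at least `2d`. For
bicyclic graphs `2d = 4 + 4/n` is small, and both inequalities become statements about the Laplacian
form `∑ (x i - x j)²`.

Right side: the forms of `G` and its complement add up to `n|x|² - (∑ x i)²`, so `μ ≤ n`. Equality
makes `G` a join, and a join with so few edges has a universal vertex; with `n + 1` edges it is then
a star plus two edges (`exists_join_of_lapForm_eq_card`, `exists_isUniversal_of_join`).

Left side: the number `30/7` separates `B_n^1` from all other bicyclic graphs. On the one hand its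
form is at most `30/7 |x|²` (`lapForm_bicyclicOne_le`). On the other hand, containing a star
`K_{1,4}`, a 4-cycle with a pendant edge, or a spider with legs 2, 2, 1 pushes `μ` above `30/7`. A
graph avoiding these is narrow: its degrees are at most three, and from a vertex of degree three one
can move on through at most one neighbour. A narrow bicyclic graph has a fork; following the only
way out of it gives a path that must end in a second fork. Along this enumeration every edge of `G`
is an edge of `B_n^1`, and equality of edge counts gives the isomorphism
(`IsBicyclic.nonempty_iso_of_isNarrow`). -/

theorem Matrix.sigmaOne_nonneg {V : Type*} [Fintype V] (M : Matrix V V ℝ) : 0 ≤ M.sigmaOne :=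
  LinearMap.singularValues_nonneg _ _

theorem Matrix.IsSymm.adjoint_comp_self {V : Type*} [Fintype V] [DecidableEq V]
    {M : Matrix V V ℝ} (hM : M.IsSymm) (x : V → ℝ) :
    ((Matrix.toEuclideanLin M).adjoint ∘ₗ Matrix.toEuclideanLin M) (WithLp.toLp 2 x) =
      WithLp.toLp 2 (M *ᵥ (M *ᵥ x)) := by
  have h : (Matrix.toEuclideanLin M).adjoint = Matrix.toEuclideanLin M := by
    rw [← Matrix.toEuclideanLin_conjTranspose_eq_adjoint, conjTranspose_eq_transpose_of_trivial, hM]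
  rw [h]
  rfl

/-- The largest singular value of a symmetric matrix is the absolute value of an eigenvalue. -/
theorem Matrix.IsSymm.exists_eigenvector_sigmaOne {V : Type*} [Fintype V] [Nonempty V]
    {M : Matrix V V ℝ} (hM : M.IsSymm) :
    ∃ x : V → ℝ, x ≠ 0 ∧ (M *ᵥ x = M.sigmaOne • x ∨ M *ᵥ x = -M.sigmaOne • x) := by
  classical
  have hd : 0 < Module.finrank ℝ (EuclideanSpace ℝ V) := by
    rw [finrank_euclideanSpace]; exact Fintype.card_pos
  obtain ⟨v, hv⟩ :=
    ((Matrix.toEuclideanLin M).hasEigenvalue_adjoint_comp_self_sq_singularValues hd).exists_hasEigenvector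
  have hs : (Matrix.toEuclideanLin M).singularValues 0 = M.sigmaOne := by
    unfold Matrix.sigmaOne; congr!
  have h1 := hv.apply_eq_smul
  rw [hs] at h1
  obtain ⟨x, rfl⟩ : ∃ x, v = WithLp.toLp 2 x := ⟨v.ofLp, rfl⟩
  have hx : x ≠ 0 := by
    rintro rfl
    exact hv.2 rfl
  rw [hM.adjoint_comp_self] at h1
  have h2 : M *ᵥ (M *ᵥ x) = M.sigmaOne ^ 2 • x := congrArg WithLp.ofLp h1
  -- From `(M - σ₁)(M + σ₁)x = 0`: either `(M + σ₁)x` vanishes, or it is itself an eigenvector for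
  -- `σ₁`.
  by_cases hy : M *ᵥ x + M.sigmaOne • x = 0
  · exact ⟨x, hx, Or.inr (by rw [neg_smul]; exact eq_neg_of_add_eq_zero_left hy)⟩
  · refine ⟨_, hy, Or.inl ?_⟩
    rw [mulVec_add, h2, mulVec_smul, smul_add, smul_smul, sq, add_comm]

/-- In an orthonormal eigenbasis of the adjoint composed with `M`, the eigenvalues are the squared
singular values, each at most `σ₁²`. -/
theorem Matrix.IsSymm.dotProduct_mulVec_self_le {V : Type*} [Fintype V]
    {M : Matrix V V ℝ} (hM : M.IsSymm) (x : V → ℝ) :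
    (M *ᵥ x) ⬝ᵥ (M *ᵥ x) ≤ M.sigmaOne ^ 2 * (x ⬝ᵥ x) := by
  classical
  set T := Matrix.toEuclideanLin M with hT
  have hs : T.singularValues 0 = M.sigmaOne := by
    unfold Matrix.sigmaOne; congr!
  have hsym := T.isSymmetric_adjoint_comp_self
  set b := hsym.eigenvectorBasis rfl with hb
  set v : EuclideanSpace ℝ V := WithLp.toLp 2 x with hv
  have h1 : inner ℝ ((T.adjoint ∘ₗ T) v) v = (M *ᵥ x) ⬝ᵥ (M *ᵥ x) := by
    rw [hv, hM.adjoint_comp_self, EuclideanSpace.inner_eq_star_dotProduct]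
    simp only [star_trivial]
    rw [dotProduct_mulVec, ← mulVec_transpose, hM.eq]
  have h2 : inner ℝ v v = x ⬝ᵥ x := by
    rw [hv, EuclideanSpace.inner_eq_star_dotProduct]; simp
  rw [← h1, ← h2, ← b.sum_inner_mul_inner, ← b.sum_inner_mul_inner v v, Finset.mul_sum]
  refine Finset.sum_le_sum fun i _ => ?_
  have h3 := hsym.eigenvectorBasis_apply_self_apply rfl v i
  rw [← hb, b.repr_apply_apply] at h3
  rw [real_inner_comm, h3, b.repr_apply_apply, ← T.sq_singularValues_fin rfl, ← hs]
  rw [real_inner_comm (b i) v]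
  have h4 := T.singularValues_antitone (Nat.zero_le i.val)
  have h5 := T.singularValues_nonneg i.val
  simp only [RCLike.ofReal_real_eq_id, id]
  have : (T.singularValues i.val)^2 ≤ (T.singularValues 0)^2 := by gcongr
  nlinarith [mul_self_nonneg (inner ℝ (b i) v)]

theorem Matrix.IsSymm.abs_dotProduct_mulVec_le {V : Type*} [Fintype V]
    {M : Matrix V V ℝ} (hM : M.IsSymm) (x : V → ℝ) :
    |x ⬝ᵥ (M *ᵥ x)| ≤ M.sigmaOne * (x ⬝ᵥ x) := by
  have h0 : 0 ≤ x ⬝ᵥ x := dotProduct_self_star_nonneg x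
  have h1 := hM.dotProduct_mulVec_self_le x
  have hc : (x ⬝ᵥ (M *ᵥ x)) ^ 2 ≤ (x ⬝ᵥ x) * ((M *ᵥ x) ⬝ᵥ (M *ᵥ x)) := by
    simpa [dotProduct, sq] using Finset.sum_mul_sq_le_sq_mul_sq Finset.univ x (M *ᵥ x)
  apply abs_le_of_sq_le_sq _ (mul_nonneg M.sigmaOne_nonneg h0)
  nlinarith

theorem Matrix.IsSymm.sigmaOne_le {V : Type*} [Fintype V] [Nonempty V]
    {M : Matrix V V ℝ} (hM : M.IsSymm) {C : ℝ}
    (h : ∀ x : V → ℝ, |x ⬝ᵥ (M *ᵥ x)| ≤ C * (x ⬝ᵥ x)) : M.sigmaOne ≤ C := by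
  obtain ⟨x, hx, h1⟩ := hM.exists_eigenvector_sigmaOne
  have hpos : 0 < x ⬝ᵥ x := dotProduct_self_star_pos_iff.2 hx
  have h2 : |x ⬝ᵥ (M *ᵥ x)| = M.sigmaOne * (x ⬝ᵥ x) := by
    rcases h1 with h1 | h1 <;> rw [h1] <;>
    simp [abs_mul, abs_of_nonneg M.sigmaOne_nonneg, abs_of_pos hpos]
  have := h x
  rw [h2] at this
  exact le_of_mul_le_mul_right this hpos

/-! ### The Laplacian form and its relation to `σ₁(LI)` -/

open Classical in
/-- The Laplacian quadratic form `∑_{ij ∈ E} (x i - x j)²`. -/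
noncomputable def SimpleGraph.lapForm {V : Type*} [Fintype V] (G : SimpleGraph V) (x : V → ℝ) : ℝ :=
  (∑ i, ∑ j, if G.Adj i j then (x i - x j) ^ 2 else 0) / 2

namespace SimpleGraph

variable {V W : Type*} [Fintype V] [Fintype W]

theorem lapForm_nonneg (G : SimpleGraph V) (x : V → ℝ) : 0 ≤ G.lapForm x := by
  classical
  unfold lapForm
  positivity

theorem LI_isSymm (G : SimpleGraph V) : G.LI.IsSymm := by
  classical
  unfold LI
  refine IsSymm.sub ?_ (isSymm_one.smul _)
  exact G.isSymm_lapMatrix ℝ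

theorem LI_mulVec (G : SimpleGraph V) (x : V → ℝ) : open Classical in
    G.LI *ᵥ x = G.lapMatrix ℝ *ᵥ x -
      (2 * (G.edgeSet.ncard : ℝ) / (Fintype.card V : ℝ)) • x := by
  classical
  unfold LI
  rw [sub_mulVec, smul_mulVec, one_mulVec]

theorem dotProduct_LI_mulVec (G : SimpleGraph V) (x : V → ℝ) :
    x ⬝ᵥ (G.LI *ᵥ x) = G.lapForm x -
      (2 * (G.edgeSet.ncard : ℝ) / (Fintype.card V : ℝ)) * (x ⬝ᵥ x) := by
  classical
  rw [LI_mulVec, dotProduct_sub, dotProduct_smul, smul_eq_mul]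
  congr 1
  rw [← toLinearMap₂'_apply', lapMatrix_toLinearMap₂']
  unfold lapForm
  congr!

/-- Upper bound on `σ₁(LI)` from an upper bound of the Laplacian form. -/
theorem sigmaOne_LI_le [Nonempty V] (G : SimpleGraph V) {C d : ℝ}
    (hd : 2 * (G.edgeSet.ncard : ℝ) / (Fintype.card V : ℝ) = d)
    (h : ∀ x : V → ℝ, G.lapForm x ≤ C * (x ⬝ᵥ x)) : G.LI.sigmaOne ≤ max (C - d) d := by
  refine G.LI_isSymm.sigmaOne_le fun x => ?_
  have h0 : 0 ≤ x ⬝ᵥ x := dotProduct_self_star_nonneg x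
  rw [dotProduct_LI_mulVec, hd, abs_le]
  have h1 := mul_le_mul_of_nonneg_right (le_max_left (C - d) d) h0
  have h2 := mul_le_mul_of_nonneg_right (le_max_right (C - d) d) h0
  constructor
  · linarith [G.lapForm_nonneg x]
  · linarith [h x]

theorem lapForm_sub_le (G : SimpleGraph V) {d : ℝ}
    (hd : 2 * (G.edgeSet.ncard : ℝ) / (Fintype.card V : ℝ) = d) (x : V → ℝ) :
    G.lapForm x - d * (x ⬝ᵥ x) ≤ G.LI.sigmaOne * (x ⬝ᵥ x) := by
  rw [← hd, ← dotProduct_LI_mulVec]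
  exact (le_abs_self _).trans (G.LI_isSymm.abs_dotProduct_mulVec_le x)

/-- `σ₁(LI)` is attained, either at a Laplacian eigenvalue or at the average degree. -/
theorem exists_lapForm_eq [Nonempty V] (G : SimpleGraph V) {d : ℝ}
    (hd : 2 * (G.edgeSet.ncard : ℝ) / (Fintype.card V : ℝ) = d) :
    ∃ x : V → ℝ, x ≠ 0 ∧ (G.lapForm x = (G.LI.sigmaOne + d) * (x ⬝ᵥ x) ∨ G.LI.sigmaOne ≤ d) := by
  obtain ⟨x, hx, h | h⟩ := G.LI_isSymm.exists_eigenvector_sigmaOne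
  all_goals
    refine ⟨x, hx, ?_⟩
    have h1 := G.dotProduct_LI_mulVec x
    rw [h, dotProduct_smul, smul_eq_mul, hd] at h1
  · left; linarith
  -- An eigenvalue `-σ₁` gives the form the value `(d - σ₁)|x|²`, which cannot be negative.
  · right
    have hpos : 0 < x ⬝ᵥ x := dotProduct_self_star_pos_iff.2 hx
    nlinarith [G.lapForm_nonneg x]

theorem Iso.lapForm_eq {G : SimpleGraph V} {H : SimpleGraph W} (φ : G ≃g H) (x : W → ℝ) :
    G.lapForm (x ∘ φ) = H.lapForm x := by
  classical
  unfold lapForm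
  congr 1
  refine Fintype.sum_equiv φ.toEquiv _ _ fun i => ?_
  refine Fintype.sum_equiv φ.toEquiv _ _ fun j => ?_
  simp [φ.map_adj_iff]

theorem Iso.ncard_edgeSet_eq {V W : Type*} {G : SimpleGraph V} {H : SimpleGraph W} (φ : G ≃g H) :
    G.edgeSet.ncard = H.edgeSet.ncard := by
  simpa [Nat.card_coe_set_eq] using Nat.card_congr φ.mapEdgeSet

theorem Iso.sigmaOne_LI_le [Nonempty V] {G : SimpleGraph V} {H : SimpleGraph W}
    (φ : G ≃g H) : G.LI.sigmaOne ≤ H.LI.sigmaOne := by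
  refine G.LI_isSymm.sigmaOne_le fun x => ?_
  have h := H.LI_isSymm.abs_dotProduct_mulVec_le (x ∘ φ.symm)
  have hx : (x ∘ φ.symm) ⬝ᵥ (x ∘ φ.symm) = x ⬝ᵥ x := by
    unfold dotProduct
    exact Fintype.sum_equiv φ.symm.toEquiv _ _ fun i => rfl
  rw [dotProduct_LI_mulVec] at h ⊢
  rwa [hx, φ.symm.lapForm_eq, φ.symm.ncard_edgeSet_eq, Fintype.card_congr φ.symm.toEquiv] at h

theorem Iso.sigmaOne_LI_eq [Nonempty V] [Nonempty W] {G : SimpleGraph V} {H : SimpleGraph W}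
    (φ : G ≃g H) : G.LI.sigmaOne = H.LI.sigmaOne :=
  le_antisymm φ.sigmaOne_LI_le φ.symm.sigmaOne_LI_le

/-- The Laplacian form of `G` dominates that of any graph that embeds into `G`. -/
theorem Hom.lapForm_le {G : SimpleGraph V} {H : SimpleGraph W} (f : H →g G)
    (hf : Function.Injective f) (y : W → ℝ) :
    ∃ x : V → ℝ, x ⬝ᵥ x = y ⬝ᵥ y ∧ H.lapForm y ≤ G.lapForm x := by
  classical
  have hz : ∀ i, i ∉ Set.range f → Function.extend f y 0 i = 0 := fun i hi => by
    rw [Function.extend_apply' _ _ _ (by simpa using hi)]; rfl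
  refine ⟨Function.extend f y 0, ?_, ?_⟩
  · unfold dotProduct
    symm
    refine Fintype.sum_of_injective f hf _ _ (fun i hi => ?_) fun i => ?_
    · simp [hz i hi]
    · simp [hf.extend_apply]
  · unfold lapForm
    gcongr ?_ / 2
    calc _ ≤ ∑ i, ∑ j, (if G.Adj (f i) (f j) then
              (Function.extend f y 0 (f i) - Function.extend f y 0 (f j)) ^ 2 else 0) := by
            refine Finset.sum_le_sum fun i _ => Finset.sum_le_sum fun j _ => ?_
            simp only [hf.extend_apply]
            by_cases h : H.Adj i j
            · rw [if_pos h, if_pos (f.map_adj h)]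
            · rw [if_neg h]; positivity
      _ ≤ ∑ i, ∑ j, (if G.Adj (f i) j then
              (Function.extend f y 0 (f i) - Function.extend f y 0 j) ^ 2 else 0) := by
            refine Finset.sum_le_sum fun i _ => ?_
            rw [← Finset.sum_image (s := Finset.univ) (g := f) (f := fun j => if G.Adj (f i) j then
              (Function.extend f y 0 (f i) - Function.extend f y 0 j) ^ 2 else 0) hf.injOn]
            exact Finset.sum_le_sum_of_subset_of_nonneg (Finset.subset_univ _)
              fun _ _ _ => by positivity
      _ ≤ _ := by
            rw [← Finset.sum_image (s := Finset.univ) (g := f) (f := fun i => ∑ j, if G.Adj i j then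
              (Function.extend f y 0 i - Function.extend f y 0 j) ^ 2 else 0) hf.injOn]
            exact Finset.sum_le_sum_of_subset_of_nonneg (Finset.subset_univ _)
              fun _ _ _ => by positivity

/-- A graph containing a small graph with a good test vector has large `σ₁(LI)`. -/
theorem lt_sigmaOne_LI_of_hom {G : SimpleGraph V} {H : SimpleGraph W} (f : H →g G)
    (hf : Function.Injective f) (y : W → ℝ) {c d : ℝ}
    (hd : 2 * (G.edgeSet.ncard : ℝ) / (Fintype.card V : ℝ) = d)
    (hpos : 0 < y ⬝ᵥ y) (h : c * (y ⬝ᵥ y) < H.lapForm y) : c - d < G.LI.sigmaOne := by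
  obtain ⟨x, hx, h1⟩ := Hom.lapForm_le f hf y
  have h2 := G.lapForm_sub_le hd x
  rw [hx] at h2
  by_contra! h3
  nlinarith

end SimpleGraph

/-! ### The bound `n`: complements, joins and universal vertices -/

namespace SimpleGraph

variable {V : Type*} [Fintype V]

/-- Together the two graphs have exactly the edges of the complete graph, whose form is explicit. -/
theorem lapForm_add_compl (G : SimpleGraph V) (x : V → ℝ) :
    G.lapForm x + Gᶜ.lapForm x = Fintype.card V * (x ⬝ᵥ x) - (∑ i, x i) ^ 2 := by
  classical
  have h1 : G.lapForm x + Gᶜ.lapForm x = (∑ i, ∑ j, (x i - x j) ^ 2) / 2 := by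
    unfold lapForm
    rw [← add_div, ← Finset.sum_add_distrib]
    congr 1
    refine Finset.sum_congr rfl fun i _ => ?_
    rw [← Finset.sum_add_distrib]
    refine Finset.sum_congr rfl fun j _ => ?_
    by_cases hij : i = j
    · simp [hij]
    · by_cases h : G.Adj i j <;> simp [h, hij]
  rw [h1]
  have h2 : ∀ i j, (x i - x j) ^ 2 = x i * x i + x j * x j - 2 * (x i * x j) := by intros; ring
  simp only [h2, Finset.sum_sub_distrib, Finset.sum_add_distrib,
    Finset.sum_const, Finset.card_univ, nsmul_eq_mul, dotProduct]
  simp only [← Finset.mul_sum, ← Finset.sum_mul]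
  ring

theorem lapForm_le_card (G : SimpleGraph V) (x : V → ℝ) :
    G.lapForm x ≤ Fintype.card V * (x ⬝ᵥ x) := by
  nlinarith [G.lapForm_add_compl x, Gᶜ.lapForm_nonneg x, sq_nonneg (∑ i, x i)]

theorem eq_of_adj_of_lapForm_eq_zero {G : SimpleGraph V} {x : V → ℝ} (h : G.lapForm x = 0)
    {i j : V} (hij : G.Adj i j) : x i = x j := by
  classical
  unfold lapForm at h
  rw [div_eq_zero_iff, or_iff_left two_ne_zero,
    Finset.sum_eq_zero_iff_of_nonneg fun _ _ => by positivity] at h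
  have h1 := h i (Finset.mem_univ _)
  rw [Finset.sum_eq_zero_iff_of_nonneg fun _ _ => by positivity] at h1
  have h2 := h1 j (Finset.mem_univ _)
  rw [if_pos hij] at h2
  exact sub_eq_zero.1 (pow_eq_zero_iff two_ne_zero |>.1 h2)

/-- A graph whose Laplacian form attains the value `n` is a join. -/
theorem exists_join_of_lapForm_eq_card {G : SimpleGraph V} {x : V → ℝ} (hx : x ≠ 0)
    (h : G.lapForm x = Fintype.card V * (x ⬝ᵥ x)) :
    ∃ A : Finset V, A.Nonempty ∧ (∃ b, b ∉ A) ∧ ∀ a ∈ A, ∀ b ∉ A, G.Adj a b := by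
  classical
  have h1 := G.lapForm_add_compl x
  have h2 : Gᶜ.lapForm x = 0 := by
    nlinarith [Gᶜ.lapForm_nonneg x, sq_nonneg (∑ i, x i)]
  have h3 : ∑ i, x i = 0 := by
    have : (∑ i, x i) ^ 2 = 0 := by linarith
    exact pow_eq_zero_iff two_ne_zero |>.1 this
  obtain ⟨a, ha⟩ : ∃ a, x a ≠ 0 := Function.ne_iff.1 hx
  -- The form of the complement vanishes, so `x` is constant along non-edges: a level set of `x` is
  -- joined to everything outside it. It is proper because `x` is nonzero with sum zero.
  refine ⟨Finset.univ.filter fun i => x i = x a, ⟨a, by simp⟩, ?_, ?_⟩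
  · by_contra! hb
    have : ∀ i, x i = x a := fun i => by simpa using hb i
    simp only [this, Finset.sum_const, Finset.card_univ, nsmul_eq_mul, mul_eq_zero, ha, or_false,
      Nat.cast_eq_zero] at h3
    exact (Fintype.card_pos_iff.2 ⟨a⟩).ne' h3
  · intro i hi j hj
    by_contra hij
    simp only [Finset.mem_filter, Finset.mem_univ, true_and] at hi hj
    have hne : i ≠ j := by rintro rfl; exact hj hi
    exact hj ((eq_of_adj_of_lapForm_eq_zero h2 ((compl_adj _ _ _).2 ⟨hne, hij⟩)).symm.trans hi)

/-- A join with few edges has a universal vertex. -/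
theorem exists_isUniversal_of_join {G : SimpleGraph V}
    (hm : G.edgeSet.ncard + 4 < 2 * Fintype.card V) {A : Finset V}
    (hA : A.Nonempty) (hA' : ∃ b, b ∉ A) (h : ∀ a ∈ A, ∀ b ∉ A, G.Adj a b) :
    ∃ c, G.IsUniversal c := by
  classical
  have hsum := G.sum_degrees_eq_twice_card_edges
  have hE : G.edgeFinset.card = G.edgeSet.ncard := by
    rw [← coe_edgeFinset, Set.ncard_coe_finset]
  have hc := Finset.card_add_card_compl A
  have hA'' : 0 < Aᶜ.card := Finset.card_pos.2 (by obtain ⟨b, hb⟩ := hA'; exact ⟨b, by simpa⟩)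
  have hA0 := hA.card_pos
  by_cases h1 : A.card = 1
  · obtain ⟨c, rfl⟩ := Finset.card_eq_one.1 h1
    exact ⟨c, fun w hw => h c (by simp) w (by simpa using hw.symm)⟩
  by_cases h2 : Aᶜ.card = 1
  · obtain ⟨c, hc'⟩ := Finset.card_eq_one.1 h2
    have hmem : ∀ i, i ∉ A ↔ i = c := fun i => by
      rw [← Finset.mem_compl, hc', Finset.mem_singleton]
    refine ⟨c, fun w hw => (h w ?_ c ((hmem c).2 rfl)).symm⟩
    by_contra hwA
    exact hw ((hmem w).1 hwA).symm
  -- With both sides of size at least two, the degree sum is at least `2|A||Aᶜ| ≥ 4(n - 2)`, more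
  -- than twice the number of edges.
  exfalso
  have hd1 : ∀ a ∈ A, Aᶜ.card ≤ G.degree a := fun a ha => by
    rw [← card_neighborFinset_eq_degree]
    refine Finset.card_le_card fun b hb => ?_
    rw [mem_neighborFinset]
    exact h a ha b (Finset.mem_compl.1 hb)
  have hd2 : ∀ b ∈ Aᶜ, A.card ≤ G.degree b := fun b hb => by
    rw [← card_neighborFinset_eq_degree]
    refine Finset.card_le_card fun a ha => ?_
    rw [mem_neighborFinset]
    exact (h a ha b (Finset.mem_compl.1 hb)).symm
  have e1 := Finset.card_nsmul_le_sum A _ _ hd1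
  have e2 := Finset.card_nsmul_le_sum Aᶜ _ _ hd2
  rw [← Finset.sum_add_sum_compl A, hE] at hsum
  simp only [smul_eq_mul] at e1 e2
  obtain ⟨p, hp⟩ := Nat.exists_eq_add_of_le (show 2 ≤ A.card by omega)
  obtain ⟨q, hq⟩ := Nat.exists_eq_add_of_le (show 2 ≤ Aᶜ.card by omega)
  rw [hp, hq] at e1 e2
  rw [hp, hq] at hc
  nlinarith

theorem IsUniversal.exists_lapForm_eq_card {G : SimpleGraph V} {c : V} (h : G.IsUniversal c)
    (hV : 2 ≤ Fintype.card V) :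
    ∃ x : V → ℝ, x ≠ 0 ∧ G.lapForm x = Fintype.card V * (x ⬝ᵥ x) := by
  classical
  -- This vector has sum zero and is constant off `c`; since `c` is isolated in the complement, the
  -- complement's form vanishes on it.
  refine ⟨fun i => (if i = c then (Fintype.card V : ℝ) else 0) - 1, ?_, ?_⟩
  · intro h0
    have := congrFun h0 c
    simp only [if_true, Pi.zero_apply] at this
    have h2 : (2 : ℝ) ≤ Fintype.card V := by exact_mod_cast hV
    linarith
  · have h1 := G.lapForm_add_compl fun i => (if i = c then (Fintype.card V : ℝ) else 0) - 1
    have h2 : Gᶜ.lapForm (fun i => (if i = c then (Fintype.card V : ℝ) else 0) - 1) = 0 := by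
      unfold lapForm
      rw [div_eq_zero_iff]
      left
      refine Finset.sum_eq_zero fun i _ => Finset.sum_eq_zero fun j _ => ?_
      by_cases hij : Gᶜ.Adj i j
      · obtain ⟨hne, hij'⟩ := (compl_adj _ _ _).1 hij
        have hi : i ≠ c := by rintro rfl; exact hij' (h hne)
        have hj : j ≠ c := by rintro rfl; exact hij' (h hne.symm).symm
        simp [hi, hj]
      · rw [if_neg hij]
    rw [h2] at h1
    simp only [Finset.sum_sub_distrib, Finset.sum_ite_eq', Finset.mem_univ, if_true,
      Finset.sum_const, Finset.card_univ, nsmul_eq_mul, mul_one, sub_self] at h1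
    linarith

/-- The value of `σ₁(LI)` for a graph with a universal vertex. -/
theorem IsUniversal.sigmaOne_LI {G : SimpleGraph V} {c : V} (h : G.IsUniversal c)
    (hV : 2 ≤ Fintype.card V) {d : ℝ}
    (hd : 2 * (G.edgeSet.ncard : ℝ) / (Fintype.card V : ℝ) = d) (hdn : 2 * d ≤ Fintype.card V) :
    G.LI.sigmaOne = Fintype.card V - d := by
  have : Nonempty V := ⟨c⟩
  apply le_antisymm
  · refine (G.sigmaOne_LI_le hd G.lapForm_le_card).trans (max_le le_rfl ?_)
    linarith
  · obtain ⟨x, hx, h1⟩ := h.exists_lapForm_eq_card hV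
    have h2 := G.lapForm_sub_le hd x
    have hpos : 0 < x ⬝ᵥ x := dotProduct_self_star_pos_iff.2 hx
    rw [h1, ← sub_mul] at h2
    exact le_of_mul_le_mul_right h2 hpos

theorem exists_isUniversal_of_sigmaOne_LI_eq {G : SimpleGraph V} [Nonempty V]
    (hm : G.edgeSet.ncard + 4 < 2 * Fintype.card V) {d : ℝ}
    (hd : 2 * (G.edgeSet.ncard : ℝ) / (Fintype.card V : ℝ) = d) (hdn : 2 * d < Fintype.card V)
    (h : G.LI.sigmaOne = Fintype.card V - d) : ∃ c, G.IsUniversal c := by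
  obtain ⟨x, hx, h1 | h1⟩ := G.exists_lapForm_eq hd
  · rw [h, sub_add_cancel] at h1
    obtain ⟨A, hA, hA', hadj⟩ := exists_join_of_lapForm_eq_card hx h1
    exact exists_isUniversal_of_join hm hA hA' hadj
  · linarith

theorem ncard_edgeSet_starGraph (c : V) :
    (starGraph c).edgeSet.ncard + 1 = Fintype.card V := by
  classical
  rw [← (isTree_starGraph c).card_edgeFinset, ← coe_edgeFinset, Set.ncard_coe_finset]

theorem IsStarPlusTwoEdges.ncard_edgeSet {G : SimpleGraph V} (h : G.IsStarPlusTwoEdges) :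
    G.edgeSet.ncard = Fintype.card V + 1 := by
  obtain ⟨c, e, f, hef, he, hf, rfl⟩ := h
  have hE : (starGraph c ⊔ fromEdgeSet {e, f}).edgeSet = (starGraph c).edgeSet ∪ {e, f} := by
    rw [edgeSet_sup, edgeSet_fromEdgeSet]
    congr 1
    rw [sdiff_eq_left, Set.disjoint_left]
    rintro a (rfl | rfl) ha
    · exact not_isDiag_of_mem_edgeSet _ he ha
    · exact not_isDiag_of_mem_edgeSet _ hf ha
  have hdisj : Disjoint (starGraph c).edgeSet {e, f} := by
    have h0 : Disjoint (starGraph c).edgeSet (starGraph c)ᶜ.edgeSet :=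
      disjoint_edgeSet.2 disjoint_compl_right
    refine h0.mono_right ?_
    rintro a (rfl | rfl)
    exacts [he, hf]
  rw [hE, Set.ncard_union_eq hdisj, Set.ncard_pair hef, ← ncard_edgeSet_starGraph c]

theorem IsStarPlusTwoEdges.exists_isUniversal {V : Type*} {G : SimpleGraph V} (h : G.IsStarPlusTwoEdges) :
    ∃ c, G.IsUniversal c := by
  obtain ⟨c, e, f, hef, he, hf, rfl⟩ := h
  exact ⟨c, fun w hw => Or.inl (starGraph_center_adj hw)⟩

/-- The star at `c` lies in `G` and uses `n - 1` of its `n + 1` edges. -/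
theorem IsUniversal.isStarPlusTwoEdges {G : SimpleGraph V} {c : V} (h : G.IsUniversal c)
    (hm : G.edgeSet.ncard = Fintype.card V + 1) : G.IsStarPlusTwoEdges := by
  have hle : starGraph c ≤ G := by
    intro a b hab
    rw [starGraph_adj] at hab
    obtain ⟨hne, rfl | rfl⟩ := hab
    · exact h hne
    · exact (h hne.symm).symm
  have hsub := edgeSet_subset_edgeSet.2 hle
  have h2 : (G.edgeSet \ (starGraph c).edgeSet).ncard = 2 := by
    rw [Set.ncard_sdiff hsub, hm, ← ncard_edgeSet_starGraph c]
    omega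
  obtain ⟨e, f, hef, hE⟩ := Set.ncard_eq_two.1 h2
  have hmem : ∀ g, g ∈ G.edgeSet → g ∉ (starGraph c).edgeSet → g ∈ (starGraph c)ᶜ.edgeSet := by
    intro g
    induction g with
    | _ a b =>
      simp only [mem_edgeSet, compl_adj]
      exact fun h1 h2 => ⟨h1.ne, h2⟩
  have he : e ∈ G.edgeSet \ (starGraph c).edgeSet := hE ▸ Or.inl rfl
  have hf : f ∈ G.edgeSet \ (starGraph c).edgeSet := hE ▸ Or.inr rfl
  refine ⟨c, e, f, hef, hmem e he.1 he.2, hmem f hf.1 hf.2, ?_⟩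
  rw [← edgeSet_inj, edgeSet_sup, edgeSet_fromEdgeSet, ← hE]
  ext g
  simp only [Set.mem_union, Set.mem_sdiff]
  constructor
  · intro hg
    by_cases hs : g ∈ (starGraph c).edgeSet
    · exact Or.inl hs
    · exact Or.inr ⟨⟨hg, hs⟩, G.not_isDiag_of_mem_edgeSet hg⟩
  · rintro (hg | hg)
    · exact hsub hg
    · exact hg.1.1

end SimpleGraph

/-! ### The Laplacian form of `B_n^1` is at most `30/7` -/

/-- The `k`-th edge of the graph consisting of the path `p 0, …, p (n - 1)` together with the
chords `p 0 — p 2` and `p (n - 3) — p (n - 1)`. -/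
def chainPair {V : Type*} (p : ℕ → V) (n k : ℕ) : V × V :=
  if k + 1 < n then (p k, p (k + 1)) else if k + 1 = n then (p 0, p 2) else (p (n - 3), p (n - 1))

theorem injOn_chainPair {V : Type*} {p : ℕ → V} {n : ℕ} (hn : 6 ≤ n)
    (hp : Set.InjOn p (Set.Iio n)) :
    Set.InjOn (fun k => s((chainPair p n k).1, (chainPair p n k).2)) (Set.Iio (n + 1)) := by
  have hp' : ∀ i j, i < n → j < n → (p i = p j ↔ i = j) := fun i j hi hj => hp.eq_iff hi hj
  intro k hk l hl h
  simp only [Set.mem_Iio] at hk hl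
  simp only [chainPair] at h
  split_ifs at h <;> rw [Sym2.eq_iff] at h <;>
    simp only [] at h <;>
    repeat rw [hp' _ _ (by omega) (by omega)] at h
  all_goals omega

/-- Left half of the quadratic form: a triangle followed by a path. -/
theorem triangle_path_form_le (X : ℕ → ℝ) {k : ℕ} (hk : 5 ≤ k) :
    (X 0 - X 2) ^ 2 + ∑ i ∈ Finset.range k, (X i - X (i + 1)) ^ 2 ≤
      30 / 7 * ∑ i ∈ Finset.range k, X i ^ 2 + 15 / 7 * X k ^ 2 := by
  induction k, hk using Nat.le_induction with
  | base =>
    simp only [Finset.sum_range_succ, Finset.sum_range_zero]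
    -- Each vertex has a budget `30/7` to share among its edges. For `a, b > 1`, `(x - y)² ≤ a x² +
    -- b y²` holds once `(a - 1)(b - 1) ≥ 1`. The triangle charges its exit `2 + 28/46 < 2.61`; the
    -- charges passed along the path then drop to `2.48`, `2.25` and the self-reproducing `15/7`,
    -- half the budget.
    have h1 : (X 0 - X 2) ^ 2 + (X 0 - X 1) ^ 2 + (X 1 - X 2) ^ 2 ≤
        30 / 7 * (X 0 ^ 2 + X 1 ^ 2) + 261 / 100 * X 2 ^ 2 := by
      nlinarith [sq_nonneg (X 0 - X 1), sq_nonneg (23 * (X 0 + X 1) + 14 * X 2), sq_nonneg (X 2)]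
    have h2 : (X 2 - X 3) ^ 2 ≤ (30 / 7 - 261 / 100) * X 2 ^ 2 + 248 / 100 * X 3 ^ 2 := by
      nlinarith [sq_nonneg (676 * X 2 + 1000 * X 3), sq_nonneg (X 2), sq_nonneg (X 3)]
    have h3 : (X 3 - X 4) ^ 2 ≤ (30 / 7 - 248 / 100) * X 3 ^ 2 + 225 / 100 * X 4 ^ 2 := by
      nlinarith [sq_nonneg (4 * X 3 + 5 * X 4), sq_nonneg (X 3), sq_nonneg (X 4)]
    have h4 : (X 4 - X 5) ^ 2 ≤ (30 / 7 - 225 / 100) * X 4 ^ 2 + 15 / 7 * X 5 ^ 2 := by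
      nlinarith [sq_nonneg (X 4 + X 5), sq_nonneg (X 4), sq_nonneg (X 5)]
    norm_num
    linarith
  | succ k hk ih =>
    rw [Finset.sum_range_succ, Finset.sum_range_succ]
    have h4 : (X k - X (k + 1)) ^ 2 ≤ 15 / 7 * X k ^ 2 + 15 / 7 * X (k + 1) ^ 2 := by
      nlinarith [sq_nonneg (X k + X (k + 1)), sq_nonneg (X k), sq_nonneg (X (k + 1))]
    linarith

/-- The two triangle-and-path halves meet at index `5`, where each charges at most `15/7`. Each half
needs at least five path edges, hence `n ≥ 11`. -/
theorem chain_form_le (X : ℕ → ℝ) {n : ℕ} (hn : 11 ≤ n) :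
    ∑ k ∈ Finset.range (n + 1), ((chainPair X n k).1 - (chainPair X n k).2) ^ 2 ≤
      30 / 7 * ∑ i ∈ Finset.range n, X i ^ 2 := by
  obtain ⟨l, rfl⟩ : ∃ l, n = 5 + l + 1 := ⟨n - 6, by omega⟩
  have hL := triangle_path_form_le X le_rfl
  have hR := triangle_path_form_le (fun j => X (5 + l - j)) (k := l) (by omega)
  have e1 : ∑ i ∈ Finset.range l, (X (5 + l - i) - X (5 + l - (i + 1))) ^ 2 =
      ∑ i ∈ Finset.range l, (X (5 + i) - X (5 + (i + 1))) ^ 2 := by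
    rw [← Finset.sum_range_reflect]
    refine Finset.sum_congr rfl fun i hi => ?_
    rw [Finset.mem_range] at hi
    rw [show 5 + l - (l - 1 - i) = 5 + (i + 1) by omega,
      show 5 + l - (l - 1 - i + 1) = 5 + i by omega]
    ring
  have e2 : ∑ i ∈ Finset.range l, X (5 + l - i) ^ 2 =
      ∑ i ∈ Finset.range l, X (5 + (i + 1)) ^ 2 := by
    rw [← Finset.sum_range_reflect]
    refine Finset.sum_congr rfl fun i hi => ?_
    rw [Finset.mem_range] at hi
    rw [show 5 + l - (l - 1 - i) = 5 + (i + 1) by omega]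
  have e3 : ∑ k ∈ Finset.range (5 + l),
      ((chainPair X (5 + l + 1) k).1 - (chainPair X (5 + l + 1) k).2) ^ 2 =
      ∑ k ∈ Finset.range (5 + l), (X k - X (k + 1)) ^ 2 := by
    refine Finset.sum_congr rfl fun i hi => ?_
    rw [Finset.mem_range] at hi
    rw [chainPair, if_pos (by omega)]
  simp only [e1, e2] at hR
  rw [Finset.sum_range_succ, Finset.sum_range_succ, e3, Finset.sum_range_add, chainPair,
    if_neg (by omega), if_pos rfl, chainPair, if_neg (by omega), if_neg (by omega),
    show 5 + l + 1 = 5 + (l + 1) by ring, Finset.sum_range_add _ 5 (l + 1),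
    Finset.sum_range_succ' _ l, show 5 + (l + 1) - 3 = 5 + l - 2 by omega,
    show 5 + (l + 1) - 1 = 5 + l - 0 by omega]
  rw [show 5 + l - l = 5 by omega] at hR
  simp only [add_assoc, add_zero] at *
  linarith [sq_nonneg (X (5 + l - 0) - X (5 + l - 2)), sub_sq_comm (X (5 + l - 0)) (X (5 + l - 2))]

namespace SimpleGraph

/-- The Laplacian form is bounded by any sum over a list of pairs covering the edges. -/
theorem lapForm_le_sum_of_cover {V ι : Type*} [Fintype V] (G : SimpleGraph V) (s : Finset ι)
    (e : ι → V × V) (h : ∀ i j, G.Adj i j → ∃ k ∈ s, s((e k).1, (e k).2) = s(i, j)) (x : V → ℝ) :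
    G.lapForm x ≤ ∑ k ∈ s, (x (e k).1 - x (e k).2) ^ 2 := by
  classical
  -- Each covering pair is entered in both orientations, matching the double count of edges in
  -- `lapForm`.
  have key : ∀ i j, (if G.Adj i j then (x i - x j) ^ 2 else 0) ≤
      ∑ k ∈ s, ((if (e k).1 = i then (if (e k).2 = j then (x (e k).1 - x (e k).2) ^ 2 else 0) else 0)
      + (if (e k).2 = i then (if (e k).1 = j then (x (e k).1 - x (e k).2) ^ 2 else 0) else 0)) := by
    intro i j
    by_cases hij : G.Adj i j
    · obtain ⟨k, hk, hk'⟩ := h i j hij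
      rw [if_pos hij]
      refine le_trans ?_ (Finset.single_le_sum (fun k _ => ?_) hk)
      · rw [Sym2.eq_iff] at hk'
        obtain ⟨h1, h2⟩ | ⟨h1, h2⟩ := hk'
        · rw [if_pos h1, if_pos h2, h1, h2]
          exact le_add_of_nonneg_right (by positivity)
        · rw [if_pos h1, if_pos h2, h1, h2, sub_sq_comm]
          exact le_add_of_nonneg_left (by positivity)
      · positivity
    · rw [if_neg hij]
      positivity
  have h2 : ∑ i, ∑ j, (if G.Adj i j then (x i - x j) ^ 2 else 0) ≤
      2 * ∑ k ∈ s, (x (e k).1 - x (e k).2) ^ 2 := by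
    refine (Finset.sum_le_sum fun i _ => Finset.sum_le_sum fun j _ => key i j).trans_eq ?_
    simp_rw [Finset.sum_comm (s := Finset.univ) (t := s), Finset.sum_add_distrib]
    simp [two_mul]
  unfold lapForm
  linarith

end SimpleGraph

/-- Extension of the identity of `Fin n` to `ℕ`. -/
def finClamp {n : ℕ} (hn : 0 < n) (k : ℕ) : Fin n := if h : k < n then ⟨k, h⟩ else ⟨0, hn⟩

theorem finClamp_val {n : ℕ} (hn : 0 < n) {k : ℕ} (h : k < n) : (finClamp hn k).val = k := by
  simp [finClamp, h]

theorem bicyclicOne_adj_iff {n : ℕ} (hn : 6 ≤ n) (i j : Fin n) :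
    (bicyclicOne n).Adj i j ↔ ∃ k ∈ Finset.range (n + 1),
      s((chainPair (finClamp (by omega : 0 < n)) n k).1,
        (chainPair (finClamp (by omega : 0 < n)) n k).2) = s(i, j) := by
  have hv : ∀ k, k < n → ∀ i : Fin n, finClamp (by omega : 0 < n) k = i ↔ k = i.val := by
    intro k hk i
    rw [Fin.ext_iff, finClamp_val _ hk]
  have hi := i.isLt
  have hj := j.isLt
  simp only [bicyclicOne, SimpleGraph.fromRel_adj, ne_eq, Fin.ext_iff, Finset.mem_range]
  constructor
  · rintro ⟨hne, (h | h | h) | (h | h | h)⟩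
    · refine ⟨i, by omega, ?_⟩
      rw [chainPair, if_pos (by omega), Sym2.eq_iff]
      simp only
      rw [hv _ (by omega), hv _ (by omega)]; omega
    · refine ⟨n - 1, by omega, ?_⟩
      rw [chainPair, if_neg (by omega), if_pos (by omega), Sym2.eq_iff]
      simp only
      rw [hv _ (by omega), hv _ (by omega)]; omega
    · refine ⟨n, by omega, ?_⟩
      rw [chainPair, if_neg (by omega), if_neg (by omega), Sym2.eq_iff]
      simp only
      rw [hv _ (by omega), hv _ (by omega)]; omega
    · refine ⟨j, by omega, ?_⟩
      rw [chainPair, if_pos (by omega), Sym2.eq_iff]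
      simp only
      rw [hv _ (by omega), hv _ (by omega), hv _ (by omega), hv _ (by omega)]; omega
    · refine ⟨n - 1, by omega, ?_⟩
      rw [chainPair, if_neg (by omega), if_pos (by omega), Sym2.eq_iff]
      simp only
      rw [hv _ (by omega), hv _ (by omega), hv _ (by omega), hv _ (by omega)]; omega
    · refine ⟨n, by omega, ?_⟩
      rw [chainPair, if_neg (by omega), if_neg (by omega), Sym2.eq_iff]
      simp only
      rw [hv _ (by omega), hv _ (by omega), hv _ (by omega), hv _ (by omega)]; omega
  · rintro ⟨k, hk, h⟩
    simp only [chainPair] at h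
    split_ifs at h <;> rw [Sym2.eq_iff] at h <;> simp only at h <;>
      rw [hv _ (by omega), hv _ (by omega), hv _ (by omega), hv _ (by omega)] at h <;> omega

theorem injOn_finClamp {n : ℕ} (hn : 0 < n) : Set.InjOn (finClamp hn) (Set.Iio n) := by
  intro i hi j hj h
  have := congrArg Fin.val h
  rwa [finClamp_val hn hi, finClamp_val hn hj] at this

theorem ncard_edgeSet_bicyclicOne {n : ℕ} (hn : 6 ≤ n) :
    (bicyclicOne n).edgeSet.ncard = n + 1 := by
  classical
  have hE : (bicyclicOne n).edgeSet =
      (fun k => s((chainPair (finClamp (by omega : 0 < n)) n k).1,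
        (chainPair (finClamp (by omega : 0 < n)) n k).2)) '' Set.Iio (n + 1) := by
    ext e
    induction e with
    | _ i j =>
      rw [SimpleGraph.mem_edgeSet, bicyclicOne_adj_iff hn]
      simp
  rw [hE, (injOn_chainPair hn (injOn_finClamp _)).ncard_image]
  simp [Set.ncard_eq_toFinset_card']

theorem lapForm_bicyclicOne_le {n : ℕ} (hn : 11 ≤ n) (x : Fin n → ℝ) :
    (bicyclicOne n).lapForm x ≤ 30 / 7 * (x ⬝ᵥ x) := by
  have h0 : 0 < n := by omega
  refine ((bicyclicOne n).lapForm_le_sum_of_cover (Finset.range (n + 1))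
    (chainPair (finClamp h0) n)
    (fun i j h => (bicyclicOne_adj_iff (by omega) i j).1 h) x).trans ?_
  have h1 := chain_form_le (fun k => x (finClamp h0 k)) hn
  have h2 : ∑ k ∈ Finset.range n, x (finClamp h0 k) ^ 2 = x ⬝ᵥ x := by
    rw [← Fin.sum_univ_eq_sum_range (fun k => x (finClamp h0 k) ^ 2) n]
    refine Finset.sum_congr rfl fun i _ => ?_
    rw [show finClamp h0 i = i from Fin.ext (finClamp_val h0 i.isLt), sq]
  rw [h2] at h1
  refine le_trans (le_of_eq ?_) h1
  refine Finset.sum_congr rfl fun k _ => ?_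
  unfold chainPair
  split_ifs <;> rfl

/-! ### Small subgraphs that force a value above `30/7` -/

namespace SimpleGraph

variable {V : Type*} [Fintype V] {G : SimpleGraph V} {d : ℝ}

theorem lt_sigmaOne_LI_of_four_neighbors
    (hd : 2 * (G.edgeSet.ncard : ℝ) / (Fintype.card V : ℝ) = d) {v a b c e : V}
    (ha : G.Adj v a) (hb : G.Adj v b) (hc : G.Adj v c) (he : G.Adj v e)
    (hnd : [a, b, c, e].Nodup) : 30 / 7 - d < G.LI.sigmaOne := by
  have hadj : ∀ i j : Fin 5, (starGraph (0 : Fin 5)).Adj i j →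
      G.Adj (![v, a, b, c, e] i) (![v, a, b, c, e] j) := by
    intro i j h
    rw [starGraph_adj] at h
    fin_cases i <;> fin_cases j <;> simp_all [G.adj_comm]
  refine lt_sigmaOne_LI_of_hom (H := starGraph (0 : Fin 5)) ⟨![v, a, b, c, e], fun h => hadj _ _ h⟩ ?_
    -- The top eigenvector of `K_{1,4}`, with eigenvalue `5`.
    ![4, -1, -1, -1, -1] hd ?_ ?_
  · have := ha.ne; have := hb.ne; have := hc.ne; have := he.ne
    intro i j h
    simp only [RelHom.coeFn_mk] at h
    fin_cases i <;> fin_cases j <;> simp_all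
  · simp [dotProduct, Fin.sum_univ_succ]; norm_num
  · simp [dotProduct, Fin.sum_univ_succ, lapForm, starGraph_adj]; norm_num

end SimpleGraph

namespace SimpleGraph

variable {V : Type*} [Fintype V] {G : SimpleGraph V} {d : ℝ}

theorem lt_sigmaOne_LI_of_square_with_pendant
    (hd : 2 * (G.edgeSet.ncard : ℝ) / (Fintype.card V : ℝ) = d) {v a b c w : V}
    (ha : G.Adj v a) (hb : G.Adj v b) (hc : G.Adj v c) (haw : G.Adj a w) (hbw : G.Adj b w)
    (hnd : [v, a, b, c, w].Nodup) : 30 / 7 - d < G.LI.sigmaOne := by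
  let H : SimpleGraph (Fin 5) :=
    fromRel fun i j => (i, j) ∈ [((0 : Fin 5), (1 : Fin 5)), (0, 2), (0, 3), (1, 4), (2, 4)]
  have hadj : ∀ i j : Fin 5, H.Adj i j → G.Adj (![v, a, b, c, w] i) (![v, a, b, c, w] j) := by
    intro i j h
    simp only [H, fromRel_adj] at h
    fin_cases i <;> fin_cases j <;> simp_all [G.adj_comm]
  refine lt_sigmaOne_LI_of_hom (H := H) ⟨![v, a, b, c, w], fun h => hadj _ _ h⟩ ?_
    -- Rayleigh quotient `173/39 ≈ 4.436`, against `30/7 ≈ 4.286`.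
    ![4, -3, -3, -1, 2] hd ?_ ?_
  · intro i j h
    simp only [RelHom.coeFn_mk] at h
    fin_cases i <;> fin_cases j <;> simp_all
  · simp [dotProduct, Fin.sum_univ_succ]; norm_num
  · simp [dotProduct, Fin.sum_univ_succ, lapForm, H]; norm_num

theorem lt_sigmaOne_LI_of_spider
    (hd : 2 * (G.edgeSet.ncard : ℝ) / (Fintype.card V : ℝ) = d) {v a b c a' b' : V}
    (ha : G.Adj v a) (hb : G.Adj v b) (hc : G.Adj v c) (haw : G.Adj a a') (hbw : G.Adj b b')
    (hnd : [v, a, b, c, a', b'].Nodup) : 30 / 7 - d < G.LI.sigmaOne := by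
  let H : SimpleGraph (Fin 6) :=
    fromRel fun i j => (i, j) ∈ [((0 : Fin 6), (1 : Fin 6)), (0, 2), (0, 3), (1, 4), (2, 5)]
  have hadj : ∀ i j : Fin 6, H.Adj i j →
      G.Adj (![v, a, b, c, a', b'] i) (![v, a, b, c, a', b'] j) := by
    intro i j h
    simp only [H, fromRel_adj] at h
    fin_cases i <;> fin_cases j <;> simp_all [G.adj_comm]
  refine lt_sigmaOne_LI_of_hom (H := H) ⟨![v, a, b, c, a', b'], fun h => hadj _ _ h⟩ ?_
    -- An integer approximation to the top eigenvector, whose eigenvalue is `(5 + √13)/2 ≈ 4.303`.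
    -- This is the tightest of the three cases.
    ![20, -10, -10, -6, 3, 3] hd ?_ ?_
  · intro i j h
    simp only [RelHom.coeFn_mk] at h
    fin_cases i <;> fin_cases j <;> simp_all
  · simp [dotProduct, Fin.sum_univ_succ]; norm_num
  · simp [dotProduct, Fin.sum_univ_succ, lapForm, H]; norm_num

/-- The two continuations either coincide, closing a 4-cycle with a pendant edge, or differ, giving
the spider. -/
theorem lt_sigmaOne_LI_of_two_long_branches
    (hd : 2 * (G.edgeSet.ncard : ℝ) / (Fintype.card V : ℝ) = d) {v a b c a' b' : V}
    (ha : G.Adj v a) (hb : G.Adj v b) (hc : G.Adj v c) (haw : G.Adj a a') (hbw : G.Adj b b')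
    (hnd : [v, a, b, c].Nodup) (ha' : a' ∉ [v, a, b, c]) (hb' : b' ∉ [v, a, b, c]) :
    30 / 7 - d < G.LI.sigmaOne := by
  by_cases h : a' = b'
  · subst h
    refine lt_sigmaOne_LI_of_square_with_pendant hd ha hb hc haw hbw ?_
    simp_all [eq_comm]
  · refine lt_sigmaOne_LI_of_spider hd ha hb hc haw hbw ?_
    simp_all [eq_comm]

end SimpleGraph

/-! ### Narrow graphs and the structure of a fork -/

namespace SimpleGraph

variable {V : Type*} [Fintype V] {G : SimpleGraph V}

theorem Connected.exists_adj_notMem (hG : G.Connected) {s : Finset V} (hs : s.Nonempty)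
    (hcard : s.card < Fintype.card V) : ∃ a ∈ s, ∃ b ∉ s, G.Adj a b := by
  classical
  obtain ⟨a, ha⟩ := hs
  obtain ⟨b, hb⟩ : ∃ b, b ∉ s := by
    by_contra! h
    rw [Finset.eq_univ_of_forall h, Finset.card_univ] at hcard
    exact lt_irrefl _ hcard
  obtain ⟨w⟩ := hG a b
  obtain ⟨d, -, h1, h2⟩ := w.exists_boundary_dart (s : Set V) (by simpa) (by simpa)
  exact ⟨d.fst, h1, d.snd, h2, d.adj⟩

/-- Local structure excluded by a small largest singular value: maximum degree at most three, and
no vertex of degree three has two neighbours from which one can move on. -/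
structure IsNarrow (G : SimpleGraph V) : Prop where
  degree_le : ∀ {v a b c e : V}, G.Adj v a → G.Adj v b → G.Adj v c → G.Adj v e →
    [a, b, c].Nodup → e = a ∨ e = b ∨ e = c
  no_branch : ∀ {v a b c a' b' : V}, G.Adj v a → G.Adj v b → G.Adj v c → G.Adj a a' → G.Adj b b' →
    [a, b, c].Nodup → a' ∉ [v, a, b, c] → b' ∉ [v, a, b, c] → False

theorem isNarrow_of_sigmaOne_LI_le {d : ℝ}
    (hd : 2 * (G.edgeSet.ncard : ℝ) / (Fintype.card V : ℝ) = d)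
    (h : G.LI.sigmaOne ≤ 30 / 7 - d) : G.IsNarrow where
  degree_le {v a b c e} ha hb hc he hnd := by
    by_contra! hne
    exact h.not_gt (lt_sigmaOne_LI_of_four_neighbors hd ha hb hc he (by simp_all [eq_comm]))
  no_branch {v a b c a' b'} ha hb hc haw hbw hnd ha' hb' := by
    have h1 := ha.ne; have h2 := hb.ne; have h3 := hc.ne
    exact h.not_gt (lt_sigmaOne_LI_of_two_long_branches hd ha hb hc haw hbw
      (by simp_all) ha' hb')

/-- At a vertex of degree three in a narrow graph, the two neighbours other than the one that
leads on are closed off, and the one that leads on has degree two. -/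
theorem IsNarrow.fork_structure (h : G.IsNarrow) (hG : G.Connected) (hV : 7 ≤ Fintype.card V)
    {v a b c c' : V} (ha : G.Adj v a) (hb : G.Adj v b) (hc : G.Adj v c) (hnd : [a, b, c].Nodup)
    (hcc : G.Adj c c') (hc' : c' ∉ [v, a, b, c]) :
    (∀ u, G.Adj a u → u = v ∨ u = b) ∧ (∀ u, G.Adj b u → u = v ∨ u = a) ∧
      (∀ u, G.Adj c u → u = v ∨ u = c') ∧ (∀ u, G.Adj v u → u = a ∨ u = b ∨ u = c) := by
  classical
  have card_lt : ∀ l : List V, l.length < Fintype.card V → l.toFinset.card < Fintype.card V :=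
    fun l hl => (l.toFinset_card_le).trans_lt hl
  have hva := ha.ne; have hvb := hb.ne; have hvc := hc.ne
  simp only [List.nodup_cons, List.mem_cons, List.not_mem_nil, or_false, not_or, List.nodup_nil,
    and_true, not_false_eq_true] at hnd hc'
  obtain ⟨⟨hab, hac⟩, hbc⟩ : (a ≠ b ∧ a ≠ c) ∧ b ≠ c := hnd
  obtain ⟨hc1, hc2, hc3, hc4⟩ : c' ≠ v ∧ c' ≠ a ∧ c' ≠ b ∧ c' ≠ c := hc'
  have hv : ∀ u, G.Adj v u → u = a ∨ u = b ∨ u = c := fun u hu =>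
    h.degree_le ha hb hc hu (by simp [hab, hac, hbc])
  have key : ∀ {a b : V}, G.Adj v a → G.Adj v b → a ≠ b → a ≠ c → b ≠ c → c' ≠ a → c' ≠ b →
      ∀ u, G.Adj a u → u = v ∨ u = b ∨ u = c := by
    intro a b ha hb hab hac hbc h2 h3 u hu
    by_contra! hne
    refine h.no_branch ha hc hb hu hcc ?_ ?_ ?_
    · simp [hab, hac, hbc.symm]
    · simp [hne, hu.ne']
    · simp [hc1, h2, h3, hc4]
  have ka := key ha hb hab hac hbc hc2 hc3
  have kb := key hb ha hab.symm hbc hac hc3 hc2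
  have key2 : ∀ {a b : V}, G.Adj v a → G.Adj v b → a ≠ b → a ≠ c → b ≠ c → c' ≠ a → c' ≠ b →
      (∀ u, G.Adj v u → u = a ∨ u = b ∨ u = c) →
      (∀ u, G.Adj a u → u = v ∨ u = b ∨ u = c) → (∀ u, G.Adj b u → u = v ∨ u = a ∨ u = c) →
      ¬ G.Adj a c := by
    intro a b ha hb hab hac hbc h2 h3 hv ka kb hadj
    -- If `a` and `c` were adjacent, `c` would be saturated by `v`, `a`, `c'`, so the graph could
    -- continue only through `c'`. Then `c` branches both through `c'` and through `v` to `b`.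
    have kc : ∀ u, G.Adj c u → u = v ∨ u = a ∨ u = c' := fun u hu =>
      h.degree_le hc.symm hadj.symm hcc hu (by simp [ha.ne, hc1.symm, h2.symm])
    obtain ⟨s, hs, t, ht, hst⟩ := hG.exists_adj_notMem (s := [v, a, b, c, c'].toFinset)
      ⟨v, by simp⟩ (card_lt _ (by simp; omega))
    simp only [List.mem_toFinset, List.mem_cons, List.not_mem_nil, or_false, not_or] at hs ht
    obtain ⟨t1, t2, t3, t4, t5⟩ := ht
    have hs' : s = c' := by
      rcases hs with rfl | rfl | rfl | rfl | rfl
      · have := hv t hst; tauto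
      · have := ka t hst; tauto
      · have := kb t hst; tauto
      · have := kc t hst; tauto
      · rfl
    subst hs'
    refine h.no_branch hc.symm hcc hadj.symm hb hst ?_ ?_ ?_
    · simp [hc1.symm, ha.ne, h2]
    · simp [hbc, hb.ne', h3.symm, hab.symm]
    · simp [t1, t2, t4, t5]
  have nac := key2 ha hb hab hac hbc hc2 hc3 hv ka kb
  have nbc := key2 hb ha hab.symm hbc hac hc3 hc2 (fun u hu => by have := hv u hu; tauto) kb ka
  have ka' : ∀ u, G.Adj a u → u = v ∨ u = b := fun u hu => by
    rcases ka u hu with h1 | h1 | rfl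
    exacts [Or.inl h1, Or.inr h1, absurd hu nac]
  have kb' : ∀ u, G.Adj b u → u = v ∨ u = a := fun u hu => by
    rcases kb u hu with h1 | h1 | rfl
    exacts [Or.inl h1, Or.inr h1, absurd hu nbc]
  refine ⟨ka', kb', fun u hu => ?_, hv⟩
  by_contra! hne
  have hua : u ≠ a := by rintro rfl; exact nac hu.symm
  have hub : u ≠ b := by rintro rfl; exact nbc hu.symm
  have kc : ∀ w, G.Adj c w → w = v ∨ w = c' ∨ w = u := fun w hw =>
    h.degree_le hc.symm hcc hu hw (by simp [hc1.symm, hne.1.symm, hne.2.symm])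
  -- A third neighbour `u` of `c` leaves only `c'` and `u` as exits from these six vertices, and
  -- there is a seventh. Either exit, with the way through `v` to `a`, makes `c` branch twice.
  obtain ⟨s, hs, t, ht, hst⟩ := hG.exists_adj_notMem (s := [v, a, b, c, c', u].toFinset)
    ⟨v, by simp⟩ (card_lt _ (by simp; omega))
  simp only [List.mem_toFinset, List.mem_cons, List.not_mem_nil, or_false, not_or] at hs ht
  obtain ⟨t1, t2, t3, t4, t5, t6⟩ := ht
  have fin : ∀ {p q : V}, G.Adj c p → G.Adj c q → p ≠ q → p ≠ v → q ≠ v → p ≠ a → q ≠ a →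
      G.Adj p t → t ≠ p → t ≠ q → False := by
    intro p q hp hq hpq hpv hqv hpa hqa hpt h1 h2
    refine h.no_branch hc.symm hp hq ha hpt ?_ ?_ ?_
    · simp [hpv.symm, hqv.symm, hpq]
    · simp [hac, ha.ne', hpa.symm, hqa.symm]
    · simp [t1, t4, h1, h2]
  rcases hs with rfl | rfl | rfl | rfl | rfl | rfl
  · have := hv t hst; tauto
  · have := ka' t hst; tauto
  · have := kb' t hst; tauto
  · have := kc t hst; tauto
  · exact fin hcc hu hne.2.symm hc1 hne.1 hc2 hua hst t5 t6
  · exact fin hu hcc hne.2 hne.1 hc1 hua hc2 hst t6 t5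

end SimpleGraph

/-! ### Reconstructing `B_n^1` along a chain -/

namespace SimpleGraph

variable {V : Type*} [Fintype V] {G : SimpleGraph V}

/-- An enumeration of the vertices along which all edges are edges of `B_n^1` is an isomorphism,
provided the number of edges is right. -/
theorem exists_iso_bicyclicOne_of_enum {n : ℕ} (hn : 6 ≤ n) (hV : Fintype.card V = n)
    (hm : G.edgeSet.ncard = n + 1) {q : ℕ → V} (hq : Set.InjOn q (Set.Iio n))
    (h : ∀ i j, i < j → j < n → G.Adj (q i) (q j) →
      j = i + 1 ∨ (i = 0 ∧ j = 2) ∨ (i + 3 = n ∧ j + 1 = n)) :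
    ∃ φ : G ≃g bicyclicOne n, ∀ i : Fin n, φ.symm i = q i := by
  have hinj : Function.Injective fun i : Fin n => q i := fun i j hij =>
    Fin.ext (hq i.isLt j.isLt hij)
  let e : Fin n ≃ V := Equiv.ofBijective _
    ((Fintype.bijective_iff_injective_and_card _).2 ⟨hinj, by simp [hV]⟩)
  have he : ∀ i, e i = q i := fun i => rfl
  have hle : G.comap e ≤ bicyclicOne n := by
    intro i j hij
    have hne := hij.ne
    rw [comap_adj, he, he] at hij
    simp only [bicyclicOne, fromRel_adj]
    refine ⟨hne, ?_⟩
    rcases lt_or_gt_of_ne hne with hlt | hlt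
    · have := h i j hlt j.isLt hij
      omega
    · have := h j i hlt i.isLt hij.symm
      omega
  have heq : G.comap e = bicyclicOne n := by
    rw [← edgeSet_inj]
    refine Set.eq_of_subset_of_ncard_le (edgeSet_subset_edgeSet.2 hle) ?_
    rw [ncard_edgeSet_bicyclicOne hn, (Iso.comap e G).ncard_edgeSet_eq, hm]
  let ψ : bicyclicOne n ≃g G := ⟨e, by intro a b; rw [← heq]; rfl⟩
  exact ⟨ψ.symm, fun i => rfl⟩

theorem Connected.card_eq_of_closed (hG : G.Connected) {p : ℕ → V} {k : ℕ} (hk : 0 < k)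
    (hp : Set.InjOn p (Set.Iio k)) (h : ∀ i < k, ∀ u, G.Adj (p i) u → ∃ j < k, u = p j) :
    k = Fintype.card V := by
  classical
  have hcard : ((Finset.range k).image p).card = k := by
    rw [Finset.card_image_of_injOn (by simpa using hp), Finset.card_range]
  refine le_antisymm (hcard ▸ Finset.card_le_univ _) ?_
  by_contra! hlt
  obtain ⟨a, ha, b, hb, hab⟩ := hG.exists_adj_notMem (s := (Finset.range k).image p)
    ⟨p 0, Finset.mem_image_of_mem _ (by simpa)⟩ (by rwa [hcard])
  obtain ⟨i, hi, rfl⟩ := Finset.mem_image.1 ha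
  obtain ⟨j, hj, rfl⟩ := h i (by simpa using hi) b hab
  exact hb (Finset.mem_image_of_mem _ (by simpa))

/-- An initial part of `B_n^1` inside `G`: all neighbours of all vertices but the last one are
as prescribed. -/
structure IsForkedChain {V : Type*} (G : SimpleGraph V) (p : ℕ → V) (k : ℕ) : Prop where
  five_le : 5 ≤ k
  injOn : Set.InjOn p (Set.Iio k)
  adj : ∀ i, 1 ≤ i → i + 1 < k → G.Adj (p i) (p (i + 1))
  zero : ∀ u, G.Adj (p 0) u → u = p 1 ∨ u = p 2
  one : ∀ u, G.Adj (p 1) u → u = p 0 ∨ u = p 2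
  two : ∀ u, G.Adj (p 2) u → u = p 0 ∨ u = p 1 ∨ u = p 3
  inner : ∀ i, 3 ≤ i → i + 1 < k → ∀ u, G.Adj (p i) u → u = p (i - 1) ∨ u = p (i + 1)

theorem IsForkedChain.exists_index {V : Type*} {G : SimpleGraph V} {p : ℕ → V} {k : ℕ} (hp : G.IsForkedChain p k) {i : ℕ}
    (hi : i + 1 < k) {u : V} (hu : G.Adj (p i) u) :
    ∃ j, u = p j ∧ j < k ∧ (j = i + 1 ∨ i = j + 1 ∨ (i = 0 ∧ j = 2) ∨ (i = 2 ∧ j = 0)) := by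
  have h5 := hp.five_le
  obtain rfl | rfl | rfl | h3 : i = 0 ∨ i = 1 ∨ i = 2 ∨ 3 ≤ i := by omega
  · rcases hp.zero u hu with h | h <;> exact ⟨_, h, by omega, by omega⟩
  · rcases hp.one u hu with h | h <;> exact ⟨_, h, by omega, by omega⟩
  · rcases hp.two u hu with h | h | h <;> exact ⟨_, h, by omega, by omega⟩
  · rcases hp.inner i h3 hi u hu with h | h <;> exact ⟨_, h, by omega, by omega⟩

/-- Earlier vertices have all their neighbours prescribed, and only index `k - 2` allows the last
vertex; `5 ≤ k` keeps the end clear of the first triangle. -/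
theorem IsForkedChain.notMem_of_adj_last {V : Type*} {G : SimpleGraph V} {p : ℕ → V} {k : ℕ} (hp : G.IsForkedChain p k)
    {u : V} (hu : G.Adj (p (k - 1)) u) (hne : u ≠ p (k - 2)) : ∀ i < k, p i ≠ u := by
  have h5 := hp.five_le
  rintro i hi rfl
  by_cases h1 : i + 1 < k
  · obtain ⟨j, hj, hjk, h⟩ := hp.exists_index h1 hu.symm
    have := hp.injOn (show k - 1 < k by omega) hjk hj
    exact hne (by rw [show i = k - 2 by omega])
  · rw [show k - 1 = i by omega] at hu
    exact hu.ne rfl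

theorem IsForkedChain.extend {V : Type*} {G : SimpleGraph V} {p : ℕ → V} {k : ℕ}
    (hp : G.IsForkedChain p k) {u : V} (hu : G.Adj (p (k - 1)) u) (hne : u ≠ p (k - 2))
    (hlast : ∀ w, G.Adj (p (k - 1)) w → w = p (k - 2) ∨ w = u) :
    G.IsForkedChain (Function.update p k u) (k + 1) := by
  have h5 := hp.five_le
  have hu' := hp.notMem_of_adj_last hu hne
  have e : ∀ i, i ≠ k → Function.update p k u i = p i := fun i hi => Function.update_of_ne hi _ _
  have ek : Function.update p k u k = u := Function.update_self ..
  refine ⟨by omega, ?_, fun i h1 h2 => ?_, ?_, ?_, ?_, fun i h1 h2 => ?_⟩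
  · intro i hi j hj hij
    simp only [Set.mem_Iio] at hi hj
    by_cases hik : i = k <;> by_cases hjk : j = k
    · omega
    · rw [hik, ek, e j hjk] at hij
      exact absurd hij.symm (hu' j (by omega))
    · rw [hjk, ek, e i hik] at hij
      exact absurd hij (hu' i (by omega))
    · rw [e i hik, e j hjk] at hij
      exact hp.injOn (show i < k by omega) (show j < k by omega) hij
  · rw [e i (by omega)]
    by_cases h3 : i + 1 = k
    · rw [h3, ek, show i = k - 1 by omega]
      exact hu
    · rw [e _ h3]
      exact hp.adj i h1 (by omega)
  · rw [e 0 (by omega), e 1 (by omega), e 2 (by omega)]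
    exact hp.zero
  · rw [e 0 (by omega), e 1 (by omega), e 2 (by omega)]
    exact hp.one
  · rw [e 0 (by omega), e 1 (by omega), e 2 (by omega), e 3 (by omega)]
    exact hp.two
  · rw [e i (by omega), e (i - 1) (by omega)]
    by_cases h3 : i + 1 = k
    · rw [h3, ek, show i = k - 1 by omega, show k - 1 - 1 = k - 2 by omega]
      exact hlast
    · rw [e _ h3]
      exact hp.inner i h1 (by omega)

/-- A forked chain in a bicyclic graph does not end in a leaf. -/
theorem IsForkedChain.exists_adj_last (hG : G.Connected) (hV : 6 ≤ Fintype.card V)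
    (hm : G.edgeSet.ncard = Fintype.card V + 1) {p : ℕ → V} {k : ℕ} (hp : G.IsForkedChain p k) :
    ∃ u, G.Adj (p (k - 1)) u ∧ u ≠ p (k - 2) := by
  have h5 := hp.five_le
  by_contra! hlast
  -- A leaf at the end closes the chain up, so it exhausts the graph. The edge count then forces
  -- `B_n^1`, whose final chord contradicts the leaf.
  have hk : k = Fintype.card V := by
    refine hG.card_eq_of_closed (by omega) hp.injOn fun i hi u hu => ?_
    by_cases h1 : i + 1 < k
    · obtain ⟨j, hj, hjk, -⟩ := hp.exists_index h1 hu
      exact ⟨j, hjk, hj⟩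
    · rw [show i = k - 1 by omega] at hu
      exact ⟨k - 2, by omega, hlast u hu⟩
  obtain ⟨φ, hφ⟩ := exists_iso_bicyclicOne_of_enum (n := k) (q := p) (by omega) hk.symm
    (by rw [hm, hk]) hp.injOn fun i j hij hj h => by
      obtain ⟨j', hj', hjk', h'⟩ := hp.exists_index (by omega : i + 1 < k) h
      have := hp.injOn hj hjk' hj'
      omega
  have hadj : (bicyclicOne k).Adj ⟨k - 1, by omega⟩ ⟨k - 3, by omega⟩ := by
    simp only [bicyclicOne, fromRel_adj, ne_eq, Fin.mk.injEq]
    omega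
  have h2 := φ.symm.map_adj_iff.2 hadj
  rw [hφ, hφ] at h2
  have := hp.injOn (show k - 3 < k by omega) (show k - 2 < k by omega) (hlast _ h2)
  omega

/-- A forked chain that ends in a fork is all of the graph. -/
theorem IsForkedChain.nonempty_iso_of_fork (h : G.IsNarrow) (hG : G.Connected)
    (hV : 7 ≤ Fintype.card V) (hm : G.edgeSet.ncard = Fintype.card V + 1) {p : ℕ → V} {k : ℕ}
    (hp : G.IsForkedChain p k) {u u' : V} (hu : G.Adj (p (k - 1)) u) (hne : u ≠ p (k - 2))
    (hu' : G.Adj (p (k - 1)) u') (hne' : u' ≠ p (k - 2)) (huu : u ≠ u') :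
    Nonempty (G ≃g bicyclicOne (Fintype.card V)) := by
  have h5 := hp.five_le
  have n1 := hp.notMem_of_adj_last hu hne
  have n2 := hp.notMem_of_adj_last hu' hne'
  have hadj1 := hp.adj (k - 2) (by omega) (by omega)
  have hadj2 := hp.adj (k - 3) (by omega) (by omega)
  rw [show k - 2 + 1 = k - 1 by omega] at hadj1
  rw [show k - 3 + 1 = k - 2 by omega] at hadj2
  have hne3 : p (k - 3) ≠ p (k - 1) := fun h => by
    have := hp.injOn (show k - 3 < k by omega) (show k - 1 < k by omega) h
    omega
  -- The fork is read from the far end: its centre is the last vertex of the chain, and the way out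
  -- leads back through `p (k - 2)` to `p (k - 3)`. Hence `u` and `u'` are closed off.
  obtain ⟨f1, f2, -, f4⟩ := h.fork_structure hG hV hu hu' hadj1.symm
    (by simp [huu, hne, hne']) hadj2.symm
    (by simp [hne3, n1 (k - 3) (by omega), n2 (k - 3) (by omega), hadj2.ne])
  set q := Function.update (Function.update p k u) (k + 1) u' with hqdef
  have e : ∀ i, i < k → q i = p i := fun i hi => by
    rw [hqdef, Function.update_of_ne (by omega), Function.update_of_ne (by omega)]
  have ek : q k = u := by
    rw [hqdef, Function.update_of_ne (by omega), Function.update_self]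
  have ek' : q (k + 1) = u' := Function.update_self ..
  have hinj : Set.InjOn q (Set.Iio (k + 2)) := by
    have : ∀ i j, i < j → j < k + 2 → q i ≠ q j := by
      intro i j hij hj heq
      obtain rfl | rfl | hj' : j = k ∨ j = k + 1 ∨ j < k := by omega
      · rw [e i hij, ek] at heq
        exact n1 i hij heq
      · rw [ek'] at heq
        obtain rfl | hi : i = k ∨ i < k := by omega
        · exact huu (ek ▸ heq)
        · rw [e i hi] at heq
          exact n2 i hi heq
      · rw [e i (by omega), e j hj'] at heq
        have := hp.injOn (show i < k by omega) hj' heq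
        omega
    intro i hi j hj hij
    rcases lt_trichotomy i j with hlt | rfl | hlt
    · exact absurd hij (this i j hlt hj)
    · rfl
    · exact absurd hij.symm (this j i hlt hi)
  have hnbr : ∀ i < k + 2, ∀ w, G.Adj (q i) w → ∃ j < k + 2, w = q j ∧
      (j = i + 1 ∨ i = j + 1 ∨ (i = 0 ∧ j = 2) ∨ (i = 2 ∧ j = 0) ∨ (i = k + 1 ∧ j + 1 = k) ∨
        (j = k + 1 ∧ i + 1 = k)) := by
    intro i hi w hw
    obtain h1 | rfl | hik | rfl : i + 1 < k ∨ i = k - 1 ∨ i = k ∨ i = k + 1 := by omega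
    · rw [e i (by omega)] at hw
      obtain ⟨j, hj, hjk, h'⟩ := hp.exists_index h1 hw
      exact ⟨j, by omega, by rw [e j hjk, hj], by omega⟩
    · rw [e _ (by omega)] at hw
      rcases f4 w hw with h' | h' | h'
      · exact ⟨k, by omega, by rw [h', ek], by omega⟩
      · exact ⟨k + 1, by omega, by rw [h', ek'], by omega⟩
      · exact ⟨k - 2, by omega, by rw [h', e _ (by omega)], by omega⟩
    · rw [hik, ek] at hw
      rcases f1 w hw with h' | h'
      · exact ⟨k - 1, by omega, by rw [h', e _ (by omega)], by omega⟩
      · exact ⟨k + 1, by omega, by rw [h', ek'], by omega⟩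
    · rw [ek'] at hw
      rcases f2 w hw with h' | h'
      · exact ⟨k - 1, by omega, by rw [h', e _ (by omega)], by omega⟩
      · exact ⟨k, by omega, by rw [h', ek], by omega⟩
  have hk : k + 2 = Fintype.card V := hG.card_eq_of_closed (by omega) hinj fun i hi w hw => by
    obtain ⟨j, hj, hj', -⟩ := hnbr i hi w hw
    exact ⟨j, hj, hj'⟩
  obtain ⟨φ, -⟩ := exists_iso_bicyclicOne_of_enum (n := Fintype.card V) (q := q) (by omega) rfl hm
    (hk ▸ hinj) fun i j hij hj hadj => by
      obtain ⟨j', hj', hjj, h'⟩ := hnbr i (by omega) _ hadj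
      have := hinj (show j < k + 2 by omega) hj' hjj
      omega
  exact ⟨φ⟩

/-- The last vertex has a further neighbour. If it is unique the chain grows, which is possible only
up to `n` vertices; otherwise the chain ends in a fork. -/
theorem IsForkedChain.nonempty_iso (h : G.IsNarrow) (hG : G.Connected)
    (hV : 7 ≤ Fintype.card V) (hm : G.edgeSet.ncard = Fintype.card V + 1) {p : ℕ → V} {k : ℕ}
    (hp : G.IsForkedChain p k) : Nonempty (G ≃g bicyclicOne (Fintype.card V)) := by
  classical
  have hkn : k ≤ Fintype.card V := by
    have := Finset.card_le_univ ((Finset.range k).image p)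
    rwa [Finset.card_image_of_injOn (by simpa using hp.injOn), Finset.card_range] at this
  obtain ⟨u, hu, hne⟩ := hp.exists_adj_last hG (by omega) hm
  by_cases hlast : ∀ w, G.Adj (p (k - 1)) w → w = p (k - 2) ∨ w = u
  · exact (hp.extend hu hne hlast).nonempty_iso h hG hV hm
  · push Not at hlast
    obtain ⟨u', hu', hne', huu⟩ := hlast
    exact hp.nonempty_iso_of_fork h hG hV hm hu hne hu' hne' huu.symm
termination_by Fintype.card V + 1 - k

/-- The only narrow bicyclic graph is `B_n^1`. -/
theorem IsBicyclic.nonempty_iso_of_isNarrow (hB : G.IsBicyclic) (h : G.IsNarrow)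
    (hV : 7 ≤ Fintype.card V) : Nonempty (G ≃g bicyclicOne (Fintype.card V)) := by
  classical
  obtain ⟨hG, hm⟩ := hB
  have start : ∀ {v a b c c' : V}, G.Adj v a → G.Adj v b → G.Adj v c → [a, b, c].Nodup →
      G.Adj c c' → c' ∉ [v, a, b, c] → Nonempty (G ≃g bicyclicOne (Fintype.card V)) := by
    intro v a b c c' ha hb hc hnd hcc hc'
    obtain ⟨f1, f2, f3, f4⟩ := h.fork_structure hG hV ha hb hc hnd hcc hc'
    have hva := ha.ne; have hvb := hb.ne; have hvc := hc.ne
    let p : ℕ → V := fun i => match i with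
      | 0 => a | 1 => b | 2 => v | 3 => c | _ => c'
    refine IsForkedChain.nonempty_iso h hG hV hm (p := p) (k := 5) ⟨le_rfl, ?_, ?_, ?_, ?_, ?_, ?_⟩
    · intro i hi j hj hij
      simp only [Set.mem_Iio] at hi hj
      simp only [List.nodup_cons, List.mem_cons, List.not_mem_nil, or_false, not_or] at hnd hc'
      interval_cases i <;> interval_cases j <;> simp_all [p]
    · intro i h1 h2
      obtain rfl | rfl | rfl : i = 1 ∨ i = 2 ∨ i = 3 := by omega
      exacts [hb.symm, hc, hcc]
    · exact fun u hu => (f1 u hu).symm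
    · exact fun u hu => (f2 u hu).symm
    · exact fun u hu => f4 u hu
    · intro i h1 h2
      obtain rfl : i = 3 := by omega
      exact f3
  -- Degrees all at most two would give degree sum at most `2n`, but it is `2(n + 1)`.
  obtain ⟨v, hv⟩ : ∃ v, 2 < (G.neighborFinset v).card := by
    by_contra! hle
    have h1 := G.sum_degrees_eq_twice_card_edges
    have h2 : ∑ v, G.degree v ≤ ∑ _v : V, 2 := Finset.sum_le_sum fun v _ => by
      rw [← card_neighborFinset_eq_degree]; exact hle v
    rw [h1, ← Set.ncard_coe_finset, coe_edgeFinset, hm] at h2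
    simp at h2
    omega
  obtain ⟨a, ha, b, hb, c, hc, hab, hac, hbc⟩ := Finset.two_lt_card.1 hv
  rw [mem_neighborFinset] at ha hb hc
  -- The closed neighbourhood of `v` is not everything, and degree at most three rules out leaving
  -- it from `v`; the neighbour through which it is left plays the role of `c`.
  obtain ⟨s, hs, t, ht, hst⟩ := hG.exists_adj_notMem (s := [v, a, b, c].toFinset) ⟨v, by simp⟩
    ((List.toFinset_card_le _).trans_lt (by simp; omega))
  simp only [List.mem_toFinset, List.mem_cons, List.not_mem_nil, or_false, not_or] at hs ht
  obtain ⟨t1, t2, t3, t4⟩ := ht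
  rcases hs with rfl | rfl | rfl | rfl
  · have := h.degree_le ha hb hc hst (by simp [hab, hac, hbc])
    tauto
  · exact start hb hc ha (by simp [hbc, hab.symm, hac.symm]) hst (by simp [t1, t2, t3, t4])
  · exact start ha hc hb (by simp [hac, hab, hbc.symm]) hst (by simp [t1, t2, t3, t4])
  · exact start ha hb hc (by simp [hab, hac, hbc]) hst (by simp [t1, t2, t3, t4])

end SimpleGraph

/-! ### The extremal theorem -/

/-- Here `S` ranges over all the graphs `B_n^*`, that is, over the stars of order `n` with two
added edges (two isomorphism types: the added edges may or may not share a vertex). -/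
theorem theorem5p7 {V : Type*} [Fintype V] (n : ℕ) (hn : 17 ≤ n) (hV : Fintype.card V = n)
    (B : SimpleGraph V) (hB : B.IsBicyclic) :
    ((bicyclicOne n).LI.sigmaOne ≤ B.LI.sigmaOne ∧
      (B.LI.sigmaOne = (bicyclicOne n).LI.sigmaOne ↔ Nonempty (B ≃g bicyclicOne n))) ∧
    (∃ S : SimpleGraph (Fin n), S.IsStarPlusTwoEdges) ∧
    ∀ S : SimpleGraph (Fin n), S.IsStarPlusTwoEdges →
      B.LI.sigmaOne ≤ S.LI.sigmaOne ∧
      (B.LI.sigmaOne = S.LI.sigmaOne ↔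
        ∃ S' : SimpleGraph (Fin n), S'.IsStarPlusTwoEdges ∧ Nonempty (B ≃g S')) := by
  subst hV
  set n := Fintype.card V with hn'
  have : Nonempty V := hB.1.nonempty
  have : Nonempty (Fin n) := ⟨⟨0, by omega⟩⟩
  have hnR : (17 : ℝ) ≤ n := by exact_mod_cast hn
  set d : ℝ := 2 * ((n + 1 : ℕ) : ℝ) / n with hd
  -- This puts `d` below `30/7 - d`, so the eigenvalue `-d` of `LI` does not interfere with the
  -- bound for `B_n^1`.
  have hd_le : 2 * d ≤ 30 / 7 := by
    rw [hd, ← mul_div_assoc, div_le_iff₀ (by linarith)]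
    push_cast
    linarith
  have hdB : 2 * (B.edgeSet.ncard : ℝ) / (Fintype.card V : ℝ) = d := by rw [hB.2]
  have hdFin : ∀ {H : SimpleGraph (Fin n)}, H.edgeSet.ncard = n + 1 →
      2 * (H.edgeSet.ncard : ℝ) / (Fintype.card (Fin n) : ℝ) = d := fun h => by
    rw [h, Fintype.card_fin]
  have hone : (bicyclicOne n).LI.sigmaOne ≤ 30 / 7 - d :=
    ((bicyclicOne n).sigmaOne_LI_le (hdFin (ncard_edgeSet_bicyclicOne (by omega)))
      (lapForm_bicyclicOne_le (by omega))).trans (max_le le_rfl (by linarith))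
  have hstar : ∀ S : SimpleGraph (Fin n), S.IsStarPlusTwoEdges → S.LI.sigmaOne = n - d := by
    intro S hS
    obtain ⟨c, hc⟩ := hS.exists_isUniversal
    have h1 := hS.ncard_edgeSet
    rw [Fintype.card_fin] at h1
    have h2 := hc.sigmaOne_LI (by rw [Fintype.card_fin]; omega) (hdFin h1)
      (by rw [Fintype.card_fin]; linarith)
    rwa [Fintype.card_fin] at h2
  have hleft : ¬ Nonempty (B ≃g bicyclicOne n) → (bicyclicOne n).LI.sigmaOne < B.LI.sigmaOne := by
    intro hiso
    by_contra! hle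
    exact hiso (hB.nonempty_iso_of_isNarrow
      (SimpleGraph.isNarrow_of_sigmaOne_LI_le hdB (hle.trans hone)) (by omega))
  refine ⟨⟨?_, ?_⟩, ?_, fun S hS => ⟨?_, ?_⟩⟩
  · by_cases hiso : Nonempty (B ≃g bicyclicOne n)
    · obtain ⟨φ⟩ := hiso
      exact φ.sigmaOne_LI_eq.ge
    · exact (hleft hiso).le
  · refine ⟨fun h => ?_, fun ⟨φ⟩ => φ.sigmaOne_LI_eq⟩
    by_contra hiso
    exact (hleft hiso).ne' h
  · refine ⟨_, ⟨0, by omega⟩, s(⟨1, by omega⟩, ⟨2, by omega⟩), s(⟨2, by omega⟩, ⟨3, by omega⟩),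
      ?_, ?_, ?_, rfl⟩ <;> simp [SimpleGraph.starGraph_adj]
  · rw [hstar S hS]
    exact (B.sigmaOne_LI_le hdB B.lapForm_le_card).trans (max_le le_rfl (by linarith))
  · rw [hstar S hS]
    constructor
    · intro h
      obtain ⟨c, hc⟩ := SimpleGraph.exists_isUniversal_of_sigmaOne_LI_eq
        (by rw [hB.2]; omega) hdB (by linarith) h
      let e : V ≃ Fin n := Fintype.equivFin V
      let φ : B.comap e.symm ≃g B := SimpleGraph.Iso.comap e.symm B
      have hcard : (B.comap e.symm).edgeSet.ncard = Fintype.card (Fin n) + 1 := by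
        rw [φ.ncard_edgeSet_eq, hB.2, Fintype.card_fin]
      have huniv : (B.comap e.symm).IsUniversal (e c) := by
        intro w hw
        rw [SimpleGraph.comap_adj, e.symm_apply_apply]
        exact hc fun hcw => hw (by rw [hcw, e.apply_symm_apply])
      exact ⟨_, huniv.isStarPlusTwoEdges hcard, ⟨φ.symm⟩⟩
    · rintro ⟨S', hS', ⟨φ⟩⟩
      rw [φ.sigmaOne_LI_eq, hstar S' hS']
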